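/- Let $\mathcal L_{\mathrm{PA}}=\{\cdot,+,\le,0,1,S\}$ and let $M$ be any (not necessarily countable) model of $\mathrm{PA}$. Fix a standard computable injective Gödel coding $\phi\mapsto\ulcorner\phi\urcorner\in\mathbb N$ of $\mathcal L_{\mathrm{PA}}$-formulas, and let $x\in y$ be the $\mathcal L_{\mathrm{PA}}$-formula expressing Ackermann membership (the $x$-th binary digit of $y$ is $1$). Natural numbers occurring in formulas stand for the numerals $S\cdots S0$. $M$ is *recursively saturated* if for every $n\in\mathbb N$, every tuple $\bar a\in M^n$ and every recursive set $p(x,\bar y)$ of $\mathcal L_{\mathrm{PA}}$-formulas in the variables $x,y_1,\dots,y_n$ (that is, the set of Gödel codes of the members of $p$ is decidable): if each finite subset of $p(x,\bar a)$ is satisfied by some element of $M$, then some element of $M$ satisfies all of $p(x,\bar a)$. $\mathrm{TB}$ is the theory in $\mathcal L_{\mathrm{PA}}\cup\{T\}$, with $T$ a new unary predicate, whose axioms are those of $\mathrm{PA}$, all instances of the induction scheme for formulas of $\mathcal L_{\mathrm{PA}}\cup\{T\}$, and the sentences $T\ulcorner\phi\urcorner\leftrightarrow\phi$ for all $\mathcal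 L_{\mathrm{PA}}$-sentences $\phi$. **Corollary.** If $M\models\mathrm{PA}$ is recursively saturated, then 1. $M$ codes its own theory, by realizing the type $\{\phi\leftrightarrow\ulcorner\phi\urcorner\in x \mid \phi \text{ an } \mathcal L_{\mathrm{PA}}\text{-sentence}\}$: there is $c\in M$ which satisfies every formula of this type and for which, moreover, $$\{k\in\mathbb N \mid M\models k\in c\}=\{\ulcorner\phi\urcorner \mid \phi\text{ an }\mathcal L_{\mathrm{PA}}\text{-sentence},\ M\models\phi\};$$ 2. $M$ has an expansion $(M,T)$, with $T\subseteq M$, that is a model of $\mathrm{TB}$. -/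

import Mathlib

namespace Arith

open FirstOrder FirstOrder.Language

universe u

/-! ### Peano Arithmetic -/

/-- Function symbols of the language of arithmetic: `0`, `1`, `S`, `+`, `·`. -/
inductive Func : ℕ → Type
  | zero : Func 0
  | one : Func 0
  | succ : Func 1
  | add : Func 2
  | mul : Func 2

/-- The only relation symbol of the language of arithmetic (besides equality): `≤`. -/
inductive Rel : ℕ → Type
  | le : Rel 2

/-- The language `{·, +, ≤, 0, 1, S}` of arithmetic. -/
def LPA : FirstOrder.Language.{0, 0} := ⟨Func, Rel⟩

section Terms

variable {β : Type*}

def zeroT : LPA.Term β := Term.func Func.zero Fin.elim0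
def oneT : LPA.Term β := Term.func Func.one Fin.elim0
def succT (t : LPA.Term β) : LPA.Term β := Term.func Func.succ ![t]
def addT (s t : LPA.Term β) : LPA.Term β := Term.func Func.add ![s, t]
def mulT (s t : LPA.Term β) : LPA.Term β := Term.func Func.mul ![s, t]

/-- The numeral `S ⋯ S 0` with `k` occurrences of `S`. -/
def numeral : ℕ → LPA.Term β
  | 0 => zeroT
  | k + 1 => succT (numeral k)

end Terms

/-- The atomic formula `s ≤ t`. -/
def leF {α : Type*} {n : ℕ} (s t : LPA.Term (α ⊕ Fin n)) : LPA.BoundedFormula α n :=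
  BoundedFormula.rel Rel.le ![s, t]

/-- The axioms for the symbols of the language:
`S x ≠ 0`, `S x = S y → x = y`, `1 = S 0`, `x + 0 = x`, `x + S y = S (x + y)`,
`x · 0 = 0`, `x · S y = x · y + x`, `x ≤ y ↔ ∃ z, x + z = y`. -/
def basicAxioms : LPA.Theory :=
  { ∀' ∼(succT (&0) =' zeroT),
    ∀' ∀' ((succT (&0) =' succT (&1)) ⟹ (&0 =' &1)),
    Term.bdEqual oneT (succT zeroT),
    ∀' (addT (&0) zeroT =' &0),
    ∀' ∀' (addT (&0) (succT (&1)) =' succT (addT (&0) (&1))),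
    ∀' (mulT (&0) zeroT =' zeroT),
    ∀' ∀' (mulT (&0) (succT (&1)) =' addT (mulT (&0) (&1)) (&0)),
    ∀' ∀' (leF (&0) (&1) ⇔ ∃' (addT (&0) (&2) =' &1)) }

/-- The induction axiom for the formula `φ(y₁, …, yₙ, x)` of a language `L` that extends the
language of arithmetic through `ι`: the universal closure (over the parameters `yᵢ`) of
`φ(ȳ, 0) ∧ ∀ x (φ(ȳ, x) → φ(ȳ, S x)) → ∀ x φ(ȳ, x)`. -/
noncomputable def inductionAxiom {L : FirstOrder.Language.{0, 0}} (ι : LPA →ᴸ L) {n : ℕ}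
    (φ : L.Formula (Fin n ⊕ Unit)) : L.Sentence :=
  let base : L.Formula (Fin n) :=
    φ.subst (Sum.elim Term.var fun _ => ι.onTerm zeroT)
  let step : L.Formula (Fin n ⊕ Unit) :=
    φ.imp (φ.subst (Sum.elim (fun i => Term.var (Sum.inl i))
      fun _ => ι.onTerm (succT (Term.var (Sum.inr ())))))
  let body : L.Formula (Fin n) := (base ⊓ step.iAlls Unit).imp (φ.iAlls Unit)
  Formula.iAlls (Fin n) (Formula.relabel Sum.inr body : L.Formula (Empty ⊕ Fin n))

/-- The induction scheme for all formulas of `L`. -/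
def inductionScheme {L : FirstOrder.Language.{0, 0}} (ι : LPA →ᴸ L) : L.Theory :=
  {σ | ∃ (n : ℕ) (φ : L.Formula (Fin n ⊕ Unit)), σ = inductionAxiom ι φ}

/-- Peano Arithmetic. -/
def PA : LPA.Theory := basicAxioms ∪ inductionScheme (LHom.id LPA)

/-! ### Gödel codes -/

/-- The Gödel code of a term. -/
def termCode {β : Type*} [Encodable β] : LPA.Term β → ℕ
  | .var b => Nat.pair 0 (Encodable.encode b)
  | .func Func.zero _ => Nat.pair 1 0
  | .func Func.one _ => Nat.pair 2 0
  | .func Func.succ ts => Nat.pair 3 (termCode (ts 0))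
  | .func Func.add ts => Nat.pair 4 (Nat.pair (termCode (ts 0)) (termCode (ts 1)))
  | .func Func.mul ts => Nat.pair 5 (Nat.pair (termCode (ts 0)) (termCode (ts 1)))

/-- The Gödel code of a formula. -/
def code {α : Type*} [Encodable α] : {n : ℕ} → LPA.BoundedFormula α n → ℕ
  | _, .falsum => Nat.pair 0 0
  | _, .equal s t => Nat.pair 1 (Nat.pair (termCode s) (termCode t))
  | _, .rel Rel.le ts => Nat.pair 2 (Nat.pair (termCode (ts 0)) (termCode (ts 1)))
  | _, .imp φ ψ => Nat.pair 3 (Nat.pair (code φ) (code ψ))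
  | _, .all φ => Nat.pair 4 (code φ)

/-! ### Recursive saturation -/

/-- A set of formulas is recursive if the set of Gödel codes of its members is decidable. -/
def IsRecursive {α : Type*} [Encodable α] (p : Set (LPA.Formula α)) : Prop :=
  ComputablePred fun k : ℕ => ∃ φ ∈ p, code φ = k

/-- `c` realizes the set of formulas `p(ȳ, x)` (with `x` the variable `Sum.inr ()`) in `M`
when the parameters `a` are put for `ȳ`. -/
def Realizes {M : Type u} [LPA.Structure M] {n : ℕ} (p : Set (LPA.Formula (Fin n ⊕ Unit)))
    (a : Fin n → M) (c : M) : Prop :=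
  ∀ φ ∈ p, φ.Realize (Sum.elim a fun _ => c)

/-- `M` is recursively saturated: every recursive set of formulas `p(x, a₁, …, aₙ)` with finitely
many parameters from `M` that is finitely satisfiable in `M` is realized in `M`. -/
def RecursivelySaturated (M : Type u) [LPA.Structure M] : Prop :=
  ∀ (n : ℕ) (p : Set (LPA.Formula (Fin n ⊕ Unit))) (a : Fin n → M),
    IsRecursive p →
    (∀ q : Set (LPA.Formula (Fin n ⊕ Unit)), q ⊆ p → q.Finite → ∃ c : M, Realizes q a c) →
    ∃ c : M, Realizes p a c

/-! ### Coded sets -/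

section Membership

variable {α : Type*} {n : ℕ}

/-- Weakening of a term by one further bound variable. -/
def up (t : LPA.Term (α ⊕ Fin n)) : LPA.Term (α ⊕ Fin (n + 1)) :=
  t.relabel (Sum.map id Fin.castSucc)

/-- The bound variable number `i`. -/
def bv {k : ℕ} (i : ℕ) (h : i < k := by omega) : LPA.Term (α ⊕ Fin k) :=
  Term.var (Sum.inr ⟨i, h⟩)

/-- The formula `r` is the remainder of `a` modulo `m`: `∃ q, a = q · m + r ∧ r < m`. -/
def remF (a m r : LPA.Term (α ⊕ Fin n)) : LPA.BoundedFormula α n :=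
  ∃' ((up a =' addT (mulT (bv n) (up m)) (up r)) ⊓ leF (succT (up r)) (up m))

/-- The formula `β(a, b, i) = r` for Gödel's beta function:
`r` is the remainder of `a` modulo `1 + (i + 1) · b`. -/
def betaF (a b i r : LPA.Term (α ⊕ Fin n)) : LPA.BoundedFormula α n :=
  remF a (succT (mulT (succT i) b)) r

/-- The formula `p = 2 ^ x`: there are `a`, `b` with `β(a, b, 0) = 1`,
`β(a, b, i + 1) = 2 β(a, b, i)` for all `i < x`, and `β(a, b, x) = p`. -/
def expF (x p : LPA.Term (α ⊕ Fin n)) : LPA.BoundedFormula α n :=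
  ∃' ∃' (betaF (bv n) (bv (n + 1)) zeroT oneT ⊓
    (∀' (leF (succT (bv (n + 2))) (up (up (up x))) ⟹
      ∃' (betaF (bv n) (bv (n + 1)) (bv (n + 2)) (bv (n + 3)) ⊓
        betaF (bv n) (bv (n + 1)) (succT (bv (n + 2))) (addT (bv (n + 3)) (bv (n + 3)))))) ⊓
    betaF (bv n) (bv (n + 1)) (up (up x)) (up (up p)))

/-- The formula `x ∈ c` (Ackermann membership: the binary digit of `c` at the place `2 ^ x` is `1`):
there are `p = 2 ^ x`, `q` and `r < p` with `c = (2 q + 1) · p + r`. -/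
def memF (x c : LPA.Term (α ⊕ Fin n)) : LPA.BoundedFormula α n :=
  ∃' ∃' ∃' (expF (up (up (up x))) (bv n) ⊓
    (up (up (up c)) =' addT (mulT (succT (addT (bv (n + 1)) (bv (n + 1)))) (bv n)) (bv (n + 2))) ⊓
    leF (succT (bv (n + 2))) (bv n))

end Membership

/-- `M ⊨ k ∈ c`, for a (standard) natural number `k` and `c` in `M`. -/
def MemCode {M : Type u} [LPA.Structure M] (k : ℕ) (c : M) : Prop :=
  Formula.Realize (memF (numeral k) (Term.var (Sum.inl ())) : LPA.Formula Unit) fun _ => c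

/-- `c` is a code in `M` of the set `X` of natural numbers: `X = {k ∈ ℕ | M ⊨ k ∈ c}`. -/
def Codes {M : Type u} [LPA.Structure M] (c : M) (X : Set ℕ) : Prop :=
  ∀ k : ℕ, k ∈ X ↔ MemCode k c

/-- The set of Gödel codes of the sentences of arithmetic that are true in `M`. -/
def theoryCodes (M : Type u) [LPA.Structure M] : Set ℕ :=
  {k | ∃ φ : LPA.Sentence, M ⊨ φ ∧ code φ = k}

/-- The set of all formulas `φ ↔ ⌜φ⌝ ∈ x`, for `φ` a sentence of arithmetic. -/
def truthType : Set (LPA.Formula (Fin 0 ⊕ Unit)) :=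
  {ψ | ∃ φ : LPA.Sentence, ψ =
    (Formula.relabel Empty.elim φ).iff
      (memF (numeral (code φ)) (Term.var (Sum.inl (Sum.inr ()))))}

/-! ### The theory of Tarski biconditionals -/

/-- The single unary predicate symbol `T`. -/
inductive TruthRel : ℕ → Type
  | T : TruthRel 1

/-- The language with the predicate symbol `T` only. -/
def LT : FirstOrder.Language.{0, 0} := ⟨fun _ => Empty, TruthRel⟩

/-- The language of arithmetic with the additional predicate symbol `T`. -/
abbrev LPAT : FirstOrder.Language.{0, 0} := LPA.sum LT

/-- The inclusion of the language of arithmetic in `LPAT`. -/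
abbrev incl : LPA →ᴸ LPAT := LHom.sumInl

/-- The sentence `T⌜φ⌝ ↔ φ`. -/
def tarskiBiconditional (φ : LPA.Sentence) : LPAT.Sentence :=
  BoundedFormula.iff
    (BoundedFormula.rel (Sum.inr TruthRel.T) ![incl.onTerm (numeral (code φ))])
    (incl.onSentence φ)

/-- `TB`: the axioms of `PA`, the induction scheme for all formulas of the language with `T`, and
the sentences `T⌜φ⌝ ↔ φ` for all sentences `φ` of arithmetic. -/
def TB : LPAT.Theory :=
  incl.onTheory PA ∪ inductionScheme incl ∪ Set.range tarskiBiconditional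

/-- `M` admits an expansion to a model of the theory `Th`. -/
def ExpandsTo (M : Type u) [LPA.Structure M] (Th : LPAT.Theory) : Prop :=
  ∃ _ : LPAT.Structure M, incl.IsExpansionOn M ∧ M ⊨ Th

end Arith

/-! Recursive saturation is applied once, without parameters, to `theoryType`. Beyond the
biconditionals of `truthType`, this type excludes from `x` every standard number that is not the
code of a sentence; `truthType` alone leaves those undecided, and the exact equality in part 1 needs
them excluded.

Finite satisfiability: each member of the type says of a single standard `k` that `k ∈ x` holds iff
`k` codes a true sentence. Finitely many such demands are met by a standard number with the right
binary digits (`exists_memCode_iff`), once it is known that the formula for Ackermann membership,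
evaluated in `M` at standard arguments, gives the true digit (`memM_natCast_iff`). This rests on
uniqueness of division with remainder in `M` and on the fact that elements below a standard number
are standard.

Recursiveness: being the code of a sentence is primitive recursive (`primrecPred_sentenceCode`), the
code of `k ∈ x` is primitive recursive in `k`, and each member of the type has a code that bounds
the number it speaks of, so membership in the type is a bounded search.

For part 2, let `T` be the set of all Ackermann members of the realizing element `c`, nonstandard
ones included. The Tarski biconditionals hold because `c` codes the theory. Since `T` is definable
from `c`, induction for formulas with `T` is induction of PA with one more parameter. -/

namespace Arith

open FirstOrder FirstOrder.Language

universe u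

/-! ### Interpretation of the symbols and of the induction axiom. -/

section Semantics

variable (M : Type u) [LPA.Structure M]

/-- The interpretation of `0`. -/
def zeroM : M := Structure.funMap (L := LPA) Func.zero Fin.elim0

/-- The interpretation of `1`. -/
def oneM : M := Structure.funMap (L := LPA) Func.one Fin.elim0

variable {M}

/-- The interpretation of `S`. -/
def succM (x : M) : M := Structure.funMap (L := LPA) Func.succ ![x]

/-- The interpretation of `+`. -/
def addM (x y : M) : M := Structure.funMap (L := LPA) Func.add ![x, y]

/-- The interpretation of `·`. -/
def mulM (x y : M) : M := Structure.funMap (L := LPA) Func.mul ![x, y]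

/-- The interpretation of `≤`. -/
def leM (x y : M) : Prop := Structure.RelMap (L := LPA) Rel.le ![x, y]

section Realize

variable {β : Type*} (v : β → M)

@[simp] theorem realize_zeroT : (zeroT : LPA.Term β).realize v = zeroM M :=
  congrArg (Structure.funMap (L := LPA) Func.zero) (Subsingleton.elim _ _)

@[simp] theorem realize_oneT : (oneT : LPA.Term β).realize v = oneM M :=
  congrArg (Structure.funMap (L := LPA) Func.one) (Subsingleton.elim _ _)

@[simp] theorem realize_succT (t : LPA.Term β) :
    (succT t).realize v = succM (t.realize v) :=
  congrArg (Structure.funMap (L := LPA) Func.succ) (funext fun i => by fin_cases i; rfl)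

@[simp] theorem realize_addT (s t : LPA.Term β) :
    (addT s t).realize v = addM (s.realize v) (t.realize v) :=
  congrArg (Structure.funMap (L := LPA) Func.add) (funext fun i => by fin_cases i <;> rfl)

@[simp] theorem realize_mulT (s t : LPA.Term β) :
    (mulT s t).realize v = mulM (s.realize v) (t.realize v) :=
  congrArg (Structure.funMap (L := LPA) Func.mul) (funext fun i => by fin_cases i <;> rfl)

end Realize

@[simp] theorem realize_leF {α : Type*} {n : ℕ} (s t : LPA.Term (α ⊕ Fin n)) (v : α → M)
    (xs : Fin n → M) :
    (leF s t).Realize v xs ↔ leM (s.realize (Sum.elim v xs)) (t.realize (Sum.elim v xs)) :=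
  iff_of_eq <| congrArg (Structure.RelMap (L := LPA) Rel.le)
    (funext fun i => by fin_cases i <;> rfl)

/-- Kept general in the language because it is used twice: to extract induction from PA and to
verify it for formulas with `T`. -/
theorem realize_inductionAxiom {L : FirstOrder.Language.{0, 0}} [L.Structure M] (ι : LPA →ᴸ L)
    [ι.IsExpansionOn M] {n : ℕ} (φ : L.Formula (Fin n ⊕ Unit)) :
    M ⊨ inductionAxiom ι φ ↔ ∀ a : Fin n → M,
      φ.Realize (Sum.elim a fun _ => zeroM M) →
      (∀ x : M, φ.Realize (Sum.elim a fun _ => x) →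
        φ.Realize (Sum.elim a fun _ => succM x)) →
      ∀ x : M, φ.Realize (Sum.elim a fun _ => x) := by
  have key : ∀ (a : Fin n → M) (P : (Unit → M) → Prop), (∀ i, P i) ↔ ∀ x : M, P fun _ => x :=
    fun a P => ⟨fun h x => h _, fun h i => h (i ())⟩
  have hb : ∀ a : Fin n → M, Formula.Realize (φ.subst (Sum.elim Term.var fun _ => ι.onTerm zeroT)) a ↔
      φ.Realize (Sum.elim a fun _ => zeroM M) := by
    intro a
    rw [Formula.Realize, BoundedFormula.realize_subst]
    refine iff_of_eq (congrArg (fun w => φ.Realize w) ?_)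
    ext (i | i) <;> simp
  have hs : ∀ (a : Fin n → M) (x : M), Formula.Realize (φ.subst (Sum.elim (fun i => Term.var (Sum.inl i))
      fun _ => ι.onTerm (succT (Term.var (Sum.inr ()))))) (Sum.elim a fun _ => x) ↔
      φ.Realize (Sum.elim a fun _ => succM x) := by
    intro a x
    rw [Formula.Realize, BoundedFormula.realize_subst]
    refine iff_of_eq (congrArg (fun w => φ.Realize w) ?_)
    ext (i | i) <;> simp
  simp only [inductionAxiom, Sentence.Realize, Formula.realize_iAlls]
  refine forall_congr' fun a => ?_
  rw [Formula.realize_relabel, show (fun i => Sum.elim default a i) ∘ Sum.inr = a from rfl,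
    Formula.realize_imp, Formula.realize_inf,
    Formula.realize_iAlls, Formula.realize_iAlls, hb, key a, key a, and_imp]
  simp only [Formula.realize_imp, hs]

end Semantics

/-! ### Semiring laws, order and division inside a model of PA. -/

section Arithmetic

variable {M : Type u} [LPA.Structure M]

theorem induction_of_PA [hM : M ⊨ PA] {n : ℕ} (φ : LPA.Formula (Fin n ⊕ Unit)) (a : Fin n → M)
    (h0 : φ.Realize (Sum.elim a fun _ => zeroM M))
    (hS : ∀ x : M, φ.Realize (Sum.elim a fun _ => x) → φ.Realize (Sum.elim a fun _ => succM x))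
    (x : M) : φ.Realize (Sum.elim a fun _ => x) :=
  (realize_inductionAxiom (LHom.id LPA) φ).1
    (hM.realize_of_mem _ (Or.inr ⟨n, φ, rfl⟩)) a h0 hS x

variable [hM : M ⊨ PA]

theorem basic_of_PA :
    (∀ x : M, succM x ≠ zeroM M) ∧ (∀ x y : M, succM x = succM y → x = y) ∧
    (oneM M = succM (zeroM M)) ∧ (∀ x : M, addM x (zeroM M) = x) ∧
    (∀ x y : M, addM x (succM y) = succM (addM x y)) ∧
    (∀ x : M, mulM x (zeroM M) = zeroM M) ∧
    (∀ x y : M, mulM x (succM y) = addM (mulM x y) x) ∧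
    (∀ x y : M, leM x y ↔ ∃ z, addM x z = y) := by
  have h : ∀ σ ∈ basicAxioms, M ⊨ σ := fun σ hσ => hM.realize_of_mem _ (Or.inl hσ)
  simp only [basicAxioms, Set.mem_insert_iff, Set.mem_singleton_iff, forall_eq_or_imp,
    forall_eq] at h
  simpa [Sentence.Realize, Formula.Realize, Fin.snoc] using h

theorem succM_ne (x : M) : succM x ≠ zeroM M := basic_of_PA.1 x
theorem succM_inj {x y : M} (h : succM x = succM y) : x = y := basic_of_PA.2.1 x y h
theorem oneM_eq : oneM M = succM (zeroM M) := basic_of_PA.2.2.1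
theorem addM_zero (x : M) : addM x (zeroM M) = x := basic_of_PA.2.2.2.1 x
theorem addM_succ (x y : M) : addM x (succM y) = succM (addM x y) := basic_of_PA.2.2.2.2.1 x y
theorem mulM_zero (x : M) : mulM x (zeroM M) = zeroM M := basic_of_PA.2.2.2.2.2.1 x
theorem mulM_succ (x y : M) : mulM x (succM y) = addM (mulM x y) x :=
  basic_of_PA.2.2.2.2.2.2.1 x y
theorem leM_iff {x y : M} : leM x y ↔ ∃ z, addM x z = y := basic_of_PA.2.2.2.2.2.2.2 x y

/-- Induction for equations between terms is all that the semiring laws need. -/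
theorem equation_induction {n : ℕ} (s t : LPA.Term (Fin n ⊕ Unit)) (a : Fin n → M)
    (h0 : s.realize (Sum.elim a fun _ => zeroM M) = t.realize (Sum.elim a fun _ => zeroM M))
    (hS : ∀ x : M, s.realize (Sum.elim a fun _ => x) = t.realize (Sum.elim a fun _ => x) →
      s.realize (Sum.elim a fun _ => succM x) = t.realize (Sum.elim a fun _ => succM x))
    (x : M) : s.realize (Sum.elim a fun _ => x) = t.realize (Sum.elim a fun _ => x) := by
  simpa using induction_of_PA (s.equal t) a (by simpa using h0) (by simpa using hS) x

/-- The induction variable. -/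
abbrev ivar {n : ℕ} : LPA.Term (Fin n ⊕ Unit) := Term.var (Sum.inr ())

/-- The parameter number `i`. -/
abbrev pvar {n : ℕ} (i : Fin n) : LPA.Term (Fin n ⊕ Unit) := Term.var (Sum.inl i)

theorem zeroM_add (x : M) : addM (zeroM M) x = x := by
  simpa using equation_induction (addT zeroT ivar) ivar (Fin.elim0 : Fin 0 → M)
    (by simp [addM_zero]) (by simp +contextual [addM_succ]) x

theorem succM_add (x y : M) : addM (succM x) y = succM (addM x y) := by
  simpa using equation_induction (addT (succT (pvar 0)) ivar) (succT (addT (pvar 0) ivar)) ![x]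
    (by simp [addM_zero]) (by simp +contextual [addM_succ]) y

theorem addM_comm (x y : M) : addM x y = addM y x := by
  simpa using equation_induction (addT (pvar 0) ivar) (addT ivar (pvar 0)) ![x]
    (by simp [addM_zero, zeroM_add]) (by simp +contextual [addM_succ, succM_add]) y

theorem addM_assoc (x y z : M) : addM (addM x y) z = addM x (addM y z) := by
  simpa using equation_induction (addT (addT (pvar 0) (pvar 1)) ivar)
    (addT (pvar 0) (addT (pvar 1) ivar)) ![x, y]
    (by simp [addM_zero]) (by simp +contextual [addM_succ]) z

theorem addM_left_comm (x y z : M) : addM x (addM y z) = addM y (addM x z) := by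
  rw [← addM_assoc, addM_comm x, addM_assoc]

theorem zeroM_mul (x : M) : mulM (zeroM M) x = zeroM M := by
  simpa using equation_induction (mulT zeroT ivar) zeroT (Fin.elim0 : Fin 0 → M)
    (by simp [mulM_zero]) (by simp +contextual [mulM_succ, addM_zero]) x

theorem succM_mul (x y : M) : mulM (succM x) y = addM (mulM x y) y := by
  simpa using equation_induction (mulT (succT (pvar 0)) ivar)
    (addT (mulT (pvar 0) ivar) ivar) ![x]
    (by simp [addM_zero, mulM_zero])
    (by simp +contextual [addM_succ, mulM_succ, addM_left_comm, addM_comm]) y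

theorem mulM_comm (x y : M) : mulM x y = mulM y x := by
  simpa using equation_induction (mulT (pvar 0) ivar) (mulT ivar (pvar 0)) ![x]
    (by simp [mulM_zero, zeroM_mul]) (by simp +contextual [mulM_succ, succM_mul]) y

theorem mulM_addM (x y z : M) : mulM x (addM y z) = addM (mulM x y) (mulM x z) := by
  simpa using equation_induction (mulT (pvar 0) (addT (pvar 1) ivar))
    (addT (mulT (pvar 0) (pvar 1)) (mulT (pvar 0) ivar)) ![x, y]
    (by simp [addM_zero, mulM_zero])
    (by simp +contextual [addM_succ, mulM_succ, addM_assoc]) z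

theorem mulM_assoc (x y z : M) : mulM (mulM x y) z = mulM x (mulM y z) := by
  simpa using equation_induction (mulT (mulT (pvar 0) (pvar 1)) ivar)
    (mulT (pvar 0) (mulT (pvar 1) ivar)) ![x, y]
    (by simp [mulM_zero]) (by simp +contextual [mulM_succ, mulM_addM]) z

theorem mulM_one (x : M) : mulM x (oneM M) = x := by
  rw [oneM_eq, mulM_succ, mulM_zero, zeroM_add]

/-- A model of Peano Arithmetic as a commutative semiring. -/
abbrev commSemiring (M : Type u) [LPA.Structure M] [M ⊨ PA] : CommSemiring M where
  add := addM
  mul := mulM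
  zero := zeroM M
  one := oneM M
  add_assoc := addM_assoc
  zero_add := zeroM_add
  add_zero := addM_zero
  add_comm := addM_comm
  left_distrib := mulM_addM
  right_distrib x y z := by
    change mulM (addM x y) z = addM (mulM x z) (mulM y z)
    rw [mulM_comm, mulM_addM, mulM_comm z, mulM_comm z]
  zero_mul := zeroM_mul
  mul_zero := mulM_zero
  mul_assoc := mulM_assoc
  one_mul x := (mulM_comm _ _).trans (mulM_one x)
  mul_one := mulM_one
  mul_comm := mulM_comm
  nsmul := @nsmulRec M ⟨zeroM M⟩ ⟨addM⟩
  nsmul_zero _ := rfl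
  nsmul_succ _ _ := rfl
  npow := @npowRec M ⟨oneM M⟩ ⟨mulM⟩
  npow_zero _ := rfl
  npow_succ _ _ := rfl

attribute [local instance] commSemiring

theorem zeroM_eq_zero : zeroM M = 0 := rfl
theorem oneM_eq_one : oneM M = 1 := rfl
theorem addM_eq_add (x y : M) : addM x y = x + y := rfl
theorem mulM_eq_mul (x y : M) : mulM x y = x * y := rfl
theorem succM_eq_add_one (x : M) : succM x = x + 1 := by
  rw [← oneM_eq_one, ← addM_eq_add, oneM_eq, addM_succ, addM_zero]
theorem leM_iff_exists_add {x y : M} : leM x y ↔ ∃ z, x + z = y := leM_iff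

theorem add_one_ne_zero' (x : M) : x + 1 ≠ 0 := by
  rw [← succM_eq_add_one]; exact succM_ne x

theorem model_add_right_cancel {x y z : M} (h : x + z = y + z) : x = y := by
  have := induction_of_PA (((addT (pvar 0) ivar).equal (addT (pvar 1) ivar)).imp
    ((pvar 0).equal (pvar 1))) ![x, y] (by simp [addM_zero])
    (by simpa [addM_succ] using fun z hz h => hz (succM_inj h)) z
  simpa [addM_eq_add, h] using this

theorem model_zero_or_succ (x : M) : x = 0 ∨ ∃ y, x = y + 1 := by
  have := induction_of_PA (M := M) (n := 0) (Term.bdEqual (Term.var (Sum.inl (Sum.inr ()))) zeroT ⊔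
    leF oneT (Term.var (Sum.inl (Sum.inr ())))) Fin.elim0 (by simp [Formula.Realize]) (fun x _ => by
      simpa [Formula.Realize, leM_iff_exists_add, succM_eq_add_one, oneM_eq_one] using
        Or.inr ⟨x, add_comm _ _⟩) x
  simpa [Formula.Realize, leM_iff_exists_add, oneM_eq_one, zeroM_eq_zero, add_comm,
    eq_comm] using this

theorem model_total (x y : M) : (∃ z, x + z = y) ∨ ∃ z, y + z = x := by
  have := induction_of_PA (M := M) (n := 1)
    (leF (Term.var (Sum.inl (Sum.inl 0))) (Term.var (Sum.inl (Sum.inr ()))) ⊔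
      leF (Term.var (Sum.inl (Sum.inr ()))) (Term.var (Sum.inl (Sum.inl 0)))) ![x]
    (by simp [Formula.Realize, leM_iff_exists_add, zeroM_eq_zero])
    (fun y => by
      simp only [Formula.Realize, BoundedFormula.realize_sup, realize_leF, Term.realize_var,
        Sum.elim_inl, Sum.elim_inr, leM_iff_exists_add, succM_eq_add_one,
        Matrix.cons_val_fin_one]
      rintro (⟨z, rfl⟩ | ⟨z, rfl⟩)
      · exact Or.inl ⟨z + 1, by ring⟩
      · rcases model_zero_or_succ z with rfl | ⟨w, rfl⟩
        · exact Or.inl ⟨1, by ring⟩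
        · exact Or.inr ⟨w, by ring⟩) y
  simpa [Formula.Realize, leM_iff_exists_add] using this

/-- Division with remainder is unique; `r < m` is expressed as `∃ s, r + 1 + s = m`. -/
theorem model_division_unique {m q r s q' r' s' : M} (h : q * m + r = q' * m + r')
    (hr : r + 1 + s = m) (hr' : r' + 1 + s' = m) : q = q' ∧ r = r' := by
  have aux : ∀ {q r s d r' : M}, q * m + r = (q + d) * m + r' → r + 1 + s = m → d = 0 := by
    intro q r s d r' h hr
    rcases model_zero_or_succ d with rfl | ⟨e, rfl⟩
    · rfl
    -- If the quotients differed by `e + 1`, the extra `m = r + 1 + s` would absorb `r`, and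
    -- cancelling `q * m + r` would make a successor equal to `0`.
    · have h1 : (0 : M) + (q * m + r) = (e * m + s + r' + 1) + (q * m + r) := by
        rw [zero_add]
        calc q * m + r = (q + (e + 1)) * m + r' := h
          _ = q * m + e * m + m + r' := by ring
          _ = q * m + e * m + (r + 1 + s) + r' := by rw [hr]
          _ = _ := by ring
      exact absurd (model_add_right_cancel h1).symm (add_one_ne_zero' _)
  rcases model_total q q' with ⟨d, rfl⟩ | ⟨d, rfl⟩
  · obtain rfl := aux h hr
    rw [add_zero, add_comm _ r, add_comm _ r'] at h
    exact ⟨(add_zero q).symm, model_add_right_cancel h⟩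
  · obtain rfl := aux h.symm hr'
    rw [add_zero, add_comm _ r, add_comm _ r'] at h
    exact ⟨add_zero q', model_add_right_cancel h⟩

end Arithmetic

attribute [local instance] commSemiring

/-! ### Ackermann membership evaluated at standard numbers. -/

section Membership

variable {M : Type u} [LPA.Structure M]

@[simp] theorem realize_up {α : Type*} {n : ℕ} (t : LPA.Term (α ⊕ Fin n)) (v : α → M)
    (xs : Fin n → M) (x : M) :
    (up t).realize (Sum.elim v (Fin.snoc xs x : Fin (n + 1) → M)) =
      t.realize (Sum.elim v xs) := by
  rw [up, Term.realize_relabel]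
  congr 1
  ext (i | i) <;> simp

@[simp] theorem realize_bv {α : Type*} {k : ℕ} (i : ℕ) (h : i < k) (v : α → M) (xs : Fin k → M) :
    (bv i h : LPA.Term (α ⊕ Fin k)).realize (Sum.elim v xs) = xs ⟨i, h⟩ := rfl

variable [hM : M ⊨ PA]

@[simp] theorem realize_numeral {β : Type*} (v : β → M) (k : ℕ) :
    (numeral k : LPA.Term β).realize v = (k : M) := by
  induction k with
  | zero => simp [numeral, zeroM_eq_zero]
  | succ k ih => simp [numeral, ih, succM_eq_add_one]

/-- `x < y`. -/
def LtM (x y : M) : Prop := ∃ s, x + 1 + s = y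

/-- `r` is the remainder of `a` modulo `m`. -/
def RemM (a m r : M) : Prop := ∃ q, a = q * m + r ∧ LtM r m

/-- `β(a, b, i) = r`. -/
def BetaM (a b i r : M) : Prop := RemM a ((i + 1) * b + 1) r

/-- `p = 2 ^ x`. -/
def ExpM (x p : M) : Prop :=
  ∃ a b, (BetaM a b 0 1 ∧ ∀ i, LtM i x → ∃ r, BetaM a b i r ∧ BetaM a b (i + 1) (r + r)) ∧
    BetaM a b x p

/-- `x` is an Ackermann member of `c`. -/
def MemM (x c : M) : Prop :=
  ∃ p q r, (ExpM x p ∧ c = (q + q + 1) * p + r) ∧ LtM r p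

section Realize

variable {α : Type*} {n : ℕ} (v : α → M) (xs : Fin n → M)

theorem realize_remF (a m r : LPA.Term (α ⊕ Fin n)) : (remF a m r).Realize v xs ↔
    RemM (a.realize (Sum.elim v xs)) (m.realize (Sum.elim v xs)) (r.realize (Sum.elim v xs)) := by
  simp [remF, RemM, LtM, leM_iff_exists_add, addM_eq_add, mulM_eq_mul, succM_eq_add_one, Fin.snoc]

theorem realize_betaF (a b i r : LPA.Term (α ⊕ Fin n)) : (betaF a b i r).Realize v xs ↔
    BetaM (a.realize (Sum.elim v xs)) (b.realize (Sum.elim v xs))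
      (i.realize (Sum.elim v xs)) (r.realize (Sum.elim v xs)) := by
  simp [betaF, BetaM, realize_remF, mulM_eq_mul, succM_eq_add_one]

theorem realize_expF (x p : LPA.Term (α ⊕ Fin n)) : (expF x p).Realize v xs ↔
    ExpM (x.realize (Sum.elim v xs)) (p.realize (Sum.elim v xs)) := by
  simp [expF, ExpM, LtM, realize_betaF, leM_iff_exists_add, addM_eq_add, zeroM_eq_zero,
    oneM_eq_one, succM_eq_add_one, Fin.snoc]

theorem realize_memF (x c : LPA.Term (α ⊕ Fin n)) : (memF x c).Realize v xs ↔
    MemM (x.realize (Sum.elim v xs)) (c.realize (Sum.elim v xs)) := by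
  simp [memF, MemM, LtM, realize_expF, leM_iff_exists_add, addM_eq_add, mulM_eq_mul,
    succM_eq_add_one, Fin.snoc]

end Realize

theorem memCode_iff (k : ℕ) (c : M) : MemCode k c ↔ MemM (k : M) c := by
  simp [MemCode, Formula.Realize, realize_memF]

theorem RemM.unique {a m r r' : M} (h : RemM a m r) (h' : RemM a m r') : r = r' := by
  obtain ⟨q, hq, s, hs⟩ := h
  obtain ⟨q', hq', s', hs'⟩ := h'
  exact (model_division_unique (hq.symm.trans hq') hs hs').2

/-- The standard numbers form an initial segment of `M`: peel successors off `y`, by induction on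
`k` outside `M`. -/
theorem eq_natCast_of_add_eq {x y : M} {k : ℕ} (h : x + y = k) : ∃ j ≤ k, x = j := by
  induction k generalizing y with
  | zero =>
    rcases model_zero_or_succ y with rfl | ⟨z, rfl⟩
    · exact ⟨0, le_rfl, by simpa using h⟩
    · rw [← add_assoc, Nat.cast_zero] at h
      exact absurd h (add_one_ne_zero' _)
  | succ k ih =>
    rcases model_zero_or_succ y with rfl | ⟨z, rfl⟩
    · exact ⟨k + 1, le_rfl, by simpa using h⟩
    · rw [← add_assoc, Nat.cast_succ] at h
      obtain ⟨j, hj, e⟩ := ih (model_add_right_cancel h)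
      exact ⟨j, hj.trans k.le_succ, e⟩

theorem ltM_natCast {i k : ℕ} (h : i < k) : LtM (i : M) k := by
  obtain ⟨s, rfl⟩ := Nat.exists_eq_add_of_lt h
  exact ⟨s, by push_cast; ring⟩

theorem exists_of_ltM_natCast {x : M} {k : ℕ} (h : LtM x (k : M)) : ∃ i < k, x = i := by
  obtain ⟨s, hs⟩ := h
  cases k with
  | zero =>
    rw [add_right_comm, Nat.cast_zero] at hs
    exact absurd hs (add_one_ne_zero' _)
  | succ k =>
    rw [add_right_comm, Nat.cast_succ] at hs
    obtain ⟨j, hj, e⟩ := eq_natCast_of_add_eq (model_add_right_cancel hs)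
    exact ⟨j, Nat.lt_succ_of_le hj, e⟩

theorem betaM_natCast (a b i : ℕ) :
    BetaM (a : M) b i ((a % ((i + 1) * b + 1) : ℕ) : M) := by
  refine ⟨((a / ((i + 1) * b + 1) : ℕ) : M), ?_, ?_⟩
  · conv_lhs => rw [← Nat.div_add_mod' a ((i + 1) * b + 1)]
    push_cast
    rfl
  · have := ltM_natCast (M := M) (Nat.mod_lt a (Nat.succ_pos ((i + 1) * b)))
    simpa using this

/-- The witnesses `a`, `b` may be nonstandard, but remainders are unique, so induction in `ℕ` up to
`k` determines every entry of the coded sequence. Conversely, a standard beta code of the powers of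
two works in `M`. -/
theorem expM_natCast_iff {k : ℕ} {p : M} : ExpM (k : M) p ↔ p = ((2 ^ k : ℕ) : M) := by
  constructor
  · rintro ⟨a, b, ⟨h0, hS⟩, hp⟩
    have key : ∀ i ≤ k, ∀ r, BetaM a b (i : M) r → r = ((2 ^ i : ℕ) : M) := by
      intro i
      induction i with
      | zero =>
        intro _ r hr
        rw [Nat.cast_zero] at hr
        simpa using RemM.unique hr h0
      | succ i ih =>
        intro hi r hr
        obtain ⟨r', hr', hr''⟩ := hS i (ltM_natCast hi)
        rw [Nat.cast_succ] at hr
        rw [RemM.unique hr hr'', ih (Nat.le_of_succ_le hi) r' hr']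
        push_cast
        ring
    exact key k le_rfl p hp
  · rintro rfl
    -- `Nat.beta` uses the same moduli `(i + 1) * b + 1` as `betaF`, so the two components of
    -- `Nat.unbeta l` serve as `a` and `b`.
    set l := (List.range (k + 1)).map (2 ^ ·) with hl
    have hb : ∀ i ≤ k, BetaM ((Nat.unbeta l).unpair.1 : M) ((Nat.unbeta l).unpair.2 : M)
        (i : M) ((2 ^ i : ℕ) : M) := by
      intro i hi
      have h := Nat.beta_unbeta_coe l ⟨i, by simp [hl]; omega⟩
      rw [Nat.beta] at h
      have h' := betaM_natCast (M := M) (Nat.unbeta l).unpair.1 (Nat.unbeta l).unpair.2 i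
      rw [h] at h'
      simpa [hl] using h'
    refine ⟨_, _, ⟨by simpa using hb 0 (Nat.zero_le k), fun i hi => ?_⟩, hb k le_rfl⟩
    obtain ⟨j, hj, rfl⟩ := exists_of_ltM_natCast hi
    refine ⟨_, hb j hj.le, ?_⟩
    have := hb (j + 1) hj
    rwa [Nat.cast_succ, pow_succ, mul_two, Nat.cast_add] at this

theorem memM_natCast_iff {k N : ℕ} : MemM (k : M) (N : M) ↔ N.testBit k = true := by
  rw [Nat.testBit_eq_decide_div_mod_eq, decide_eq_true_eq]
  have hN : (N : M) = ((N / 2 ^ k : ℕ) : M) * ((2 ^ k : ℕ) : M) + ((N % 2 ^ k : ℕ) : M) := by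
    conv_lhs => rw [← Nat.div_add_mod' N (2 ^ k)]
    push_cast
    rfl
  have hlt : LtM ((N % 2 ^ k : ℕ) : M) ((2 ^ k : ℕ) : M) :=
    ltM_natCast (Nat.mod_lt _ (by positivity))
  constructor
  · rintro ⟨p, q, r, ⟨hp, hc⟩, s, hs⟩
    rw [expM_natCast_iff] at hp
    subst hp
    obtain ⟨t, ht⟩ := hlt
    have hq := (model_division_unique (hN.symm.trans hc) ht hs).1
    -- The witness `q` is an arbitrary element of `M`, so parity is compared inside `M`: an even
    -- quotient would have the remainders `0` and `1` modulo `2` at once.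
    by_contra hne
    obtain ⟨h, hh⟩ : 2 ∣ N / 2 ^ k := by omega
    have h0 : (h : M) * 2 + 0 = q * 2 + 1 := by
      rw [hh] at hq
      push_cast at hq
      rw [add_zero, mul_comm, hq]
      ring
    have := (model_division_unique h0 (s := 1) (s' := 0) (by norm_num) (by norm_num)).2
    exact add_one_ne_zero' (0 : M) (by rw [zero_add, ← this])
  · intro h
    refine ⟨_, ((N / 2 ^ k / 2 : ℕ) : M), _, ⟨expM_natCast_iff.2 rfl, ?_⟩, hlt⟩
    rw [hN]
    congr 2
    rw [← Nat.cast_add, ← Nat.cast_succ]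
    congr 1
    omega

theorem exists_memCode_iff (X : Set ℕ) (n : ℕ) :
    ∃ c : M, ∀ k < n, k ∈ X ↔ MemCode k c := by
  classical
  refine ⟨(Nat.ofBits (n := n) fun i => decide ((i : ℕ) ∈ X) : ℕ), fun k hk => ?_⟩
  rw [memCode_iff, memM_natCast_iff, Nat.testBit_ofBits_lt _ _ hk, decide_eq_true_eq]

end Membership

/-! ### Injectivity of the coding and its invariance under relabelling. -/

section Injectivity

variable {α β γ : Type*} [Encodable α] [Encodable β] [Encodable γ]

theorem encode_fin {n : ℕ} (i : Fin n) : Encodable.encode i = (i : ℕ) := rfl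

theorem termCode_injective : Function.Injective (termCode : LPA.Term β → ℕ) := by
  intro s
  induction s with
  | var b =>
    rintro (c | ⟨_ | _ | _ | _ | _, ts⟩) h <;>
      simp_all [termCode, Nat.pair_eq_pair]
  | func f ts ih =>
    rintro (c | ⟨g, us⟩) h
    · cases f <;> simp [termCode, Nat.pair_eq_pair] at h
    · cases f <;> cases g <;> simp [termCode, Nat.pair_eq_pair] at h <;>
        refine congrArg _ (funext fun i => ?_) <;> fin_cases i
      · exact ih 0 h
      · exact ih 0 h.1
      · exact ih 1 h.2
      · exact ih 0 h.1
      · exact ih 1 h.2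

/-- Only for a fixed `n`, since codes do not record the number of bound variables in scope. It
ensures that a code in `theoryCodes` comes from one sentence only. -/
theorem code_injective {n : ℕ} :
    Function.Injective (code : LPA.BoundedFormula α n → ℕ) := by
  intro φ
  induction φ with
  | falsum =>
    rintro (_ | ⟨s, t⟩ | ⟨⟨⟩, us⟩ | ⟨φ, ψ⟩ | φ) h
    · rfl
    all_goals simp [code, Nat.pair_eq_pair] at h
  | equal s t =>
    rintro (_ | ⟨s', t'⟩ | ⟨⟨⟩, us⟩ | ⟨φ, ψ⟩ | φ) h <;> simp [code, Nat.pair_eq_pair] at h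
    rw [termCode_injective h.1, termCode_injective h.2]
  | rel R ts =>
    cases R
    rintro (_ | ⟨s', t'⟩ | ⟨⟨⟩, us⟩ | ⟨φ, ψ⟩ | φ) h <;> simp [code, Nat.pair_eq_pair] at h
    refine congrArg _ (funext fun i => ?_)
    fin_cases i
    exacts [termCode_injective h.1, termCode_injective h.2]
  | imp φ ψ ih ih' =>
    rintro (_ | ⟨s', t'⟩ | ⟨⟨⟩, us⟩ | ⟨φ, ψ⟩ | φ) h <;> simp [code, Nat.pair_eq_pair] at h
    rw [ih h.1, ih' h.2]
  | all φ ih =>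
    rintro (_ | ⟨s', t'⟩ | ⟨⟨⟩, us⟩ | ⟨φ, ψ⟩ | φ) h <;> simp [code, Nat.pair_eq_pair] at h
    rw [ih h]

theorem termCode_relabel (g : β → γ) (hg : ∀ b, Encodable.encode (g b) = Encodable.encode b)
    (t : LPA.Term β) : termCode (t.relabel g) = termCode t := by
  induction t with
  | var b => simp [Term.relabel, termCode, hg]
  | func f ts ih => cases f <;> simp [Term.relabel, termCode, ih]

/-- Bound variable `i` is encoded as `2 * i + 1` whatever the type of free variables, and a sentence
has no others. -/
theorem code_relabel_sentence (g : Empty → β ⊕ Fin 0) {n : ℕ} (φ : LPA.BoundedFormula Empty n) :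
    code (φ.relabel g) = code φ := by
  have ht : ∀ {n : ℕ} (t : LPA.Term (Empty ⊕ Fin n)),
      termCode (t.relabel (BoundedFormula.relabelAux g n)) = termCode t := fun t =>
    termCode_relabel _ (by
      rintro (a | i)
      · exact a.elim
      · simp [BoundedFormula.relabelAux, encode_fin]) t
  induction φ with
  | falsum => rfl
  | equal s t => simp [BoundedFormula.relabel, BoundedFormula.mapTermRel, code, ht]
  | rel R ts => cases R; exact congrArg _ (congrArg₂ Nat.pair (ht (ts 0)) (ht (ts 1)))
  | imp φ ψ ih ih' => simp [BoundedFormula.relabel_imp, code, ih, ih']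
  | all φ ih => simp [BoundedFormula.relabel_all, code, ih]

end Injectivity

/-! ### Deciding which numbers are codes of sentences. -/

section Recursion

/-- The list of the first `n` values of the function defined by recursion on the list of its
previous values. -/
def valueTable (G : List ℕ → ℕ) (n : ℕ) : List ℕ :=
  n.rec [] fun _ l => l ++ [G l]

/-- The function defined by recursion on the list of its previous values. -/
def valueRec (G : List ℕ → ℕ) (n : ℕ) : ℕ := G (valueTable G n)

theorem valueTable_eq (G : List ℕ → ℕ) (n : ℕ) :
    valueTable G n = (List.range n).map (valueRec G) := by
  induction n with
  | zero => rfl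
  | succ n ih =>
    rw [List.range_succ, List.map_append, ← ih]
    rfl

theorem valueTable_length (G : List ℕ → ℕ) (n : ℕ) : (valueTable G n).length = n := by
  simp [valueTable_eq]

theorem valueTable_getD (G : List ℕ → ℕ) {n i : ℕ} (h : i < n) :
    (valueTable G n).getD i 0 = valueRec G i := by
  simp [valueTable_eq, h]

/-- Course-of-values recursion reduces to ordinary primitive recursion on the table of values. -/
theorem primrec_valueRec {G : List ℕ → ℕ} (hG : Primrec G) : Primrec (valueRec G) :=
  hG.comp <| Primrec.nat_rec₁ [] <|
    Primrec.list_concat.comp Primrec.snd (hG.comp Primrec.snd)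

/-- The maximum of two numbers, and `0` if one of them is `0`. -/
def strictMax (a b : ℕ) : ℕ := if a = 0 then 0 else if b = 0 then 0 else max a b

theorem primrec_strictMax : Primrec₂ strictMax :=
  Primrec.ite (Primrec.eq.comp Primrec.fst (Primrec.const 0)) (Primrec.const 0) <|
    Primrec.ite (Primrec.eq.comp Primrec.snd (Primrec.const 0)) (Primrec.const 0) <|
      Primrec.nat_max.comp Primrec.fst Primrec.snd

/-- The number `a` encodes a level that is at most `n`: levels `m` are encoded by `m + 1`,
and `0` means that there is no level. -/
def LevelLE (n a : ℕ) : Prop := 0 < a ∧ a ≤ n + 1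

theorem levelLE_strictMax {n a b : ℕ} :
    LevelLE n (strictMax a b) ↔ LevelLE n a ∧ LevelLE n b := by
  unfold LevelLE strictMax
  split_ifs <;> omega

/-- The recursion step of `termLevel`. -/
def termLevelStep (l : List ℕ) : ℕ :=
  -- The table before stage `k` has length `k`, so `l.length` is the code under analysis. A bound
  -- variable `i` has argument `2 * i + 1` and least level `i + 1`, stored as `i + 2`.
  if l.length.unpair.1 = 0 then
    if l.length.unpair.2 % 2 = 1 then l.length.unpair.2 / 2 + 2 else 0
  else if l.length.unpair.1 ≤ 2 then if l.length.unpair.2 = 0 then 1 else 0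
  else if l.length.unpair.1 = 3 then l.getD l.length.unpair.2 0
  else if l.length.unpair.1 ≤ 5 then
    strictMax (l.getD l.length.unpair.2.unpair.1 0) (l.getD l.length.unpair.2.unpair.2 0)
  else 0

/-- `m + 1` if `k` is the code of a term with bound variables only and `m` is the least number such
that the bound variables have indices below `m`; `0` if `k` is not the code of such a term. -/
def termLevel : ℕ → ℕ := valueRec termLevelStep

/-- The recursion step of `formulaLevel`. -/
def formulaLevelStep (l : List ℕ) : ℕ :=
  if l.length.unpair.1 = 0 then if l.length.unpair.2 = 0 then 1 else 0
  else if l.length.unpair.1 ≤ 2 then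
    strictMax (termLevel l.length.unpair.2.unpair.1) (termLevel l.length.unpair.2.unpair.2)
  else if l.length.unpair.1 = 3 then
    strictMax (l.getD l.length.unpair.2.unpair.1 0) (l.getD l.length.unpair.2.unpair.2 0)
  else if l.length.unpair.1 = 4 then
    -- A quantifier lowers the level by one, except that invalid codes (`0`) and level `0` (stored
    -- as `1`) stay as they are.
    if l.getD l.length.unpair.2 0 ≤ 1 then l.getD l.length.unpair.2 0
    else l.getD l.length.unpair.2 0 - 1
  else 0

/-- `m + 1` if `k` is the code of a formula without free variables in `α` and `m` is the least level
on which such a formula exists; `0` if `k` is not the code of such a formula. -/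
def formulaLevel : ℕ → ℕ := valueRec formulaLevelStep

section Primrec

theorem primrec_length_tag : Primrec fun l : List ℕ => l.length.unpair.1 :=
  Primrec.fst.comp (Primrec.unpair.comp Primrec.list_length)

theorem primrec_length_arg : Primrec fun l : List ℕ => l.length.unpair.2 :=
  Primrec.snd.comp (Primrec.unpair.comp Primrec.list_length)

theorem primrec_length_arg₁ : Primrec fun l : List ℕ => l.length.unpair.2.unpair.1 :=
  Primrec.fst.comp (Primrec.unpair.comp primrec_length_arg)

theorem primrec_length_arg₂ : Primrec fun l : List ℕ => l.length.unpair.2.unpair.2 :=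
  Primrec.snd.comp (Primrec.unpair.comp primrec_length_arg)

theorem primrec_getD {f : List ℕ → ℕ} (hf : Primrec f) : Primrec fun l : List ℕ => l.getD (f l) 0 :=
  (Primrec.list_getD 0).comp Primrec.id hf

theorem primrec_termLevel : Primrec termLevel := by
  refine primrec_valueRec ?_
  refine Primrec.ite (Primrec.eq.comp primrec_length_tag (Primrec.const 0)) ?_ ?_
  · exact Primrec.ite (Primrec.eq.comp (Primrec.nat_mod.comp primrec_length_arg (Primrec.const 2))
      (Primrec.const 1)) (Primrec.nat_add.comp
        (Primrec.nat_div.comp primrec_length_arg (Primrec.const 2)) (Primrec.const 2))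
      (Primrec.const 0)
  refine Primrec.ite (Primrec.nat_le.comp primrec_length_tag (Primrec.const 2)) ?_ ?_
  · exact Primrec.ite (Primrec.eq.comp primrec_length_arg (Primrec.const 0)) (Primrec.const 1)
      (Primrec.const 0)
  refine Primrec.ite (Primrec.eq.comp primrec_length_tag (Primrec.const 3)) ?_ ?_
  · exact primrec_getD primrec_length_arg
  · exact Primrec.ite (Primrec.nat_le.comp primrec_length_tag (Primrec.const 5))
      (primrec_strictMax.comp (primrec_getD primrec_length_arg₁)
        (primrec_getD primrec_length_arg₂)) (Primrec.const 0)

theorem primrec_formulaLevel : Primrec formulaLevel := by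
  refine primrec_valueRec ?_
  refine Primrec.ite (Primrec.eq.comp primrec_length_tag (Primrec.const 0)) ?_ ?_
  · exact Primrec.ite (Primrec.eq.comp primrec_length_arg (Primrec.const 0)) (Primrec.const 1)
      (Primrec.const 0)
  refine Primrec.ite (Primrec.nat_le.comp primrec_length_tag (Primrec.const 2)) ?_ ?_
  · exact primrec_strictMax.comp (primrec_termLevel.comp primrec_length_arg₁)
      (primrec_termLevel.comp primrec_length_arg₂)
  refine Primrec.ite (Primrec.eq.comp primrec_length_tag (Primrec.const 3)) ?_ ?_
  · exact primrec_strictMax.comp (primrec_getD primrec_length_arg₁)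
      (primrec_getD primrec_length_arg₂)
  refine Primrec.ite (Primrec.eq.comp primrec_length_tag (Primrec.const 4)) ?_ (Primrec.const 0)
  have h := primrec_getD primrec_length_arg
  exact Primrec.ite (Primrec.nat_le.comp h (Primrec.const 1)) h
    (Primrec.nat_sub.comp h (Primrec.const 1))

end Primrec

theorem lt_pair_of_pos {a b : ℕ} (h : 0 < a) : b < Nat.pair a b :=
  (Nat.lt_add_of_pos_left h).trans_le (Nat.add_le_pair a b)

theorem fst_lt_pair {a : ℕ} (b : ℕ) (h : 0 < a) : b.unpair.1 < Nat.pair a b :=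
  (Nat.unpair_left_le b).trans_lt (lt_pair_of_pos h)

theorem snd_lt_pair {a : ℕ} (b : ℕ) (h : 0 < a) : b.unpair.2 < Nat.pair a b :=
  (Nat.unpair_right_le b).trans_lt (lt_pair_of_pos h)

theorem termLevel_pair (a b : ℕ) : termLevel (Nat.pair a b) =
    if a = 0 then if b % 2 = 1 then b / 2 + 2 else 0
    else if a ≤ 2 then if b = 0 then 1 else 0
    else if a = 3 then termLevel b
    else if a ≤ 5 then strictMax (termLevel b.unpair.1) (termLevel b.unpair.2)
    else 0 := by
  rw [termLevel, valueRec, termLevelStep]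
  simp only [valueTable_length, Nat.unpair_pair]
  rcases Nat.eq_zero_or_pos a with rfl | ha
  · rfl
  rw [valueTable_getD _ (lt_pair_of_pos ha), valueTable_getD _ (fst_lt_pair b ha),
    valueTable_getD _ (snd_lt_pair b ha)]

theorem formulaLevel_pair (a b : ℕ) : formulaLevel (Nat.pair a b) =
    if a = 0 then if b = 0 then 1 else 0
    else if a ≤ 2 then strictMax (termLevel b.unpair.1) (termLevel b.unpair.2)
    else if a = 3 then strictMax (formulaLevel b.unpair.1) (formulaLevel b.unpair.2)
    else if a = 4 then if formulaLevel b ≤ 1 then formulaLevel b else formulaLevel b - 1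
    else 0 := by
  rw [formulaLevel, valueRec, formulaLevelStep]
  simp only [valueTable_length, Nat.unpair_pair]
  rcases Nat.eq_zero_or_pos a with rfl | ha
  · rfl
  rw [valueTable_getD _ (lt_pair_of_pos ha), valueTable_getD _ (fst_lt_pair b ha),
    valueTable_getD _ (snd_lt_pair b ha)]

theorem levelLE_termLevel_iff {n k : ℕ} :
    LevelLE n (termLevel k) ↔ ∃ t : LPA.Term (Empty ⊕ Fin n), termCode t = k := by
  constructor
  · induction k using Nat.strong_induction_on with
    | _ k ih =>
      obtain ⟨a, b, rfl⟩ : ∃ a b, k = Nat.pair a b := ⟨_, _, (Nat.pair_unpair k).symm⟩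
      intro h
      rw [termLevel_pair] at h
      split_ifs at h with h0 hb h2 hb h3 h5
      · subst h0
        refine ⟨Term.var (Sum.inr ⟨b / 2, by unfold LevelLE at h; omega⟩), ?_⟩
        simp only [termCode, Encodable.encode_inr, encode_fin]
        congr 1
        omega
      · exact absurd h.1 (lt_irrefl 0)
      · subst hb
        obtain rfl | rfl : a = 1 ∨ a = 2 := by omega
        · exact ⟨zeroT, rfl⟩
        · exact ⟨oneT, rfl⟩
      · exact absurd h.1 (lt_irrefl 0)
      · subst h3
        obtain ⟨t, rfl⟩ := ih b (lt_pair_of_pos (by omega)) h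
        exact ⟨succT t, rfl⟩
      · rw [levelLE_strictMax] at h
        obtain ⟨s, hs⟩ := ih _ (fst_lt_pair b (by omega)) h.1
        obtain ⟨t, ht⟩ := ih _ (snd_lt_pair b (by omega)) h.2
        obtain rfl | rfl : a = 4 ∨ a = 5 := by omega
        · exact ⟨addT s t, by simp [addT, termCode, hs, ht]⟩
        · exact ⟨mulT s t, by simp [mulT, termCode, hs, ht]⟩
      · exact absurd h.1 (lt_irrefl 0)
  · rintro ⟨t, rfl⟩
    induction t with
    | var b =>
      rcases b with b | i
      · exact b.elim
      · have := i.isLt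
        simp only [termCode, Encodable.encode_inr, encode_fin, termLevel_pair, if_true]
        rw [if_pos (by omega)]
        unfold LevelLE
        omega
    | func f ts ih =>
      cases f <;> simp [termCode, termLevel_pair, levelLE_strictMax, ih]
      all_goals exact ⟨by omega, by omega⟩

/-- Stated for all `n` at once, because the quantifier case passes from level `n` to level `n + 1`.
-/
theorem levelLE_formulaLevel_iff {n k : ℕ} :
    LevelLE n (formulaLevel k) ↔ ∃ φ : LPA.BoundedFormula Empty n, code φ = k := by
  constructor
  · induction k using Nat.strong_induction_on generalizing n with
    | _ k ih =>
      obtain ⟨a, b, rfl⟩ : ∃ a b, k = Nat.pair a b := ⟨_, _, (Nat.pair_unpair k).symm⟩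
      intro h
      rw [formulaLevel_pair] at h
      split_ifs at h with h0 hb h2 h3 h4 hb
      · subst h0 hb
        exact ⟨.falsum, rfl⟩
      · exact absurd h.1 (lt_irrefl 0)
      · rw [levelLE_strictMax, levelLE_termLevel_iff, levelLE_termLevel_iff] at h
        obtain ⟨⟨s, hs⟩, ⟨t, ht⟩⟩ := h
        obtain rfl | rfl : a = 1 ∨ a = 2 := by omega
        · exact ⟨.equal s t, by simp [code, hs, ht]⟩
        · exact ⟨leF s t, by simp [leF, code, hs, ht]⟩
      · subst h3
        rw [levelLE_strictMax] at h
        obtain ⟨φ, hφ⟩ := ih _ (fst_lt_pair b (by omega)) h.1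
        obtain ⟨ψ, hψ⟩ := ih _ (snd_lt_pair b (by omega)) h.2
        exact ⟨φ.imp ψ, by simp [code, hφ, hψ]⟩
      · subst h4
        obtain ⟨φ, hφ⟩ := ih (n := n + 1) b (lt_pair_of_pos (by omega))
          ⟨h.1, hb.trans (by omega)⟩
        exact ⟨φ.all, by simp [code, hφ]⟩
      · subst h4
        obtain ⟨φ, hφ⟩ := ih (n := n + 1) b (lt_pair_of_pos (by omega))
          (by unfold LevelLE at h ⊢; omega)
        exact ⟨φ.all, by simp [code, hφ]⟩
      · exact absurd h.1 (lt_irrefl 0)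
  · rintro ⟨φ, rfl⟩
    have ht : ∀ {n : ℕ} (t : LPA.Term (Empty ⊕ Fin n)), LevelLE n (termLevel (termCode t)) :=
      fun t => levelLE_termLevel_iff.2 ⟨t, rfl⟩
    induction φ with
    | falsum => simp [code, formulaLevel_pair, LevelLE]
    | equal s t => simp [code, formulaLevel_pair, levelLE_strictMax, ht]
    | rel R ts => cases R; simp [code, formulaLevel_pair, levelLE_strictMax, ht]
    | imp φ ψ ih ih' => simp [code, formulaLevel_pair, levelLE_strictMax, ih, ih']
    | all φ ih =>
      simp only [code, formulaLevel_pair]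
      unfold LevelLE at ih ⊢
      norm_num
      split_ifs <;> omega

theorem primrecPred_sentenceCode : PrimrecPred fun k => ∃ φ : LPA.Sentence, code φ = k :=
  (Primrec.eq.comp primrec_formulaLevel (Primrec.const 1)).of_eq fun k => by
    have := levelLE_formulaLevel_iff (n := 0) (k := k)
    rw [LevelLE] at this
    exact (show formulaLevel k = 1 ↔ _ by omega).trans this

end Recursion

/-! ### Codes of formulas with numerals are primitive recursive. -/

section PrimrecCodes

variable {α : Type*} [Encodable α] {n : ℕ}

/-- The codes of the terms `t k`, with their variables renamed in any way, are primitive recursive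
in `k`. -/
def PrimrecTerm (t : ℕ → LPA.Term (α ⊕ Fin n)) : Prop :=
  ∀ (m : ℕ) (ρ : α ⊕ Fin n → α ⊕ Fin m), Primrec fun k => termCode ((t k).relabel ρ)

/-- The codes of the formulas `φ k` are primitive recursive in `k`. -/
def PrimrecFormula (φ : ℕ → LPA.BoundedFormula α n) : Prop := Primrec fun k => code (φ k)

theorem PrimrecTerm.const (t : LPA.Term (α ⊕ Fin n)) : PrimrecTerm fun _ => t :=
  fun _ _ => Primrec.const _

theorem PrimrecTerm.primrec {t : ℕ → LPA.Term (α ⊕ Fin n)} (h : PrimrecTerm t) :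
    Primrec fun k => termCode (t k) :=
  (h n id).of_eq fun k => by rw [Term.relabel_id]

/-- Weakening is itself a renaming; this is why `PrimrecTerm` quantifies over all renamings. -/
theorem PrimrecTerm.up {t : ℕ → LPA.Term (α ⊕ Fin n)} (h : PrimrecTerm t) :
    PrimrecTerm fun k => up (t k) := fun m ρ =>
  (h m (ρ ∘ Sum.map id Fin.castSucc)).of_eq fun k =>
    congrArg termCode (Term.relabel_relabel _ _ (t k)).symm

theorem PrimrecTerm.succT {t : ℕ → LPA.Term (α ⊕ Fin n)} (h : PrimrecTerm t) :
    PrimrecTerm fun k => succT (t k) := fun m ρ =>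
  Primrec₂.natPair.comp (Primrec.const 3) (h m ρ)

theorem PrimrecTerm.addT {s t : ℕ → LPA.Term (α ⊕ Fin n)} (hs : PrimrecTerm s)
    (ht : PrimrecTerm t) : PrimrecTerm fun k => addT (s k) (t k) := fun m ρ =>
  Primrec₂.natPair.comp (Primrec.const 4) (Primrec₂.natPair.comp (hs m ρ) (ht m ρ))

theorem PrimrecTerm.mulT {s t : ℕ → LPA.Term (α ⊕ Fin n)} (hs : PrimrecTerm s)
    (ht : PrimrecTerm t) : PrimrecTerm fun k => mulT (s k) (t k) := fun m ρ =>
  Primrec₂.natPair.comp (Primrec.const 5) (Primrec₂.natPair.comp (hs m ρ) (ht m ρ))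

theorem PrimrecTerm.numeral : PrimrecTerm (numeral : ℕ → LPA.Term (α ⊕ Fin n)) := by
  intro m ρ
  have h : Primrec₂ fun (_ : ℕ) (c : ℕ) => Nat.pair 3 c :=
    Primrec₂.natPair.comp (Primrec.const 3) Primrec.snd
  refine (Primrec.nat_rec₁ (Nat.pair 1 0) h).of_eq fun k => ?_
  induction k with
  | zero => rfl
  | succ k ih => exact congrArg (Nat.pair 3) ih

theorem PrimrecFormula.equal {s t : ℕ → LPA.Term (α ⊕ Fin n)} (hs : PrimrecTerm s)
    (ht : PrimrecTerm t) : PrimrecFormula fun k => (s k).bdEqual (t k) :=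
  Primrec₂.natPair.comp (Primrec.const 1) (Primrec₂.natPair.comp hs.primrec ht.primrec)

theorem PrimrecFormula.leF {s t : ℕ → LPA.Term (α ⊕ Fin n)} (hs : PrimrecTerm s)
    (ht : PrimrecTerm t) : PrimrecFormula fun k => leF (s k) (t k) :=
  Primrec₂.natPair.comp (Primrec.const 2) (Primrec₂.natPair.comp hs.primrec ht.primrec)

theorem PrimrecFormula.imp {φ ψ : ℕ → LPA.BoundedFormula α n} (hφ : PrimrecFormula φ)
    (hψ : PrimrecFormula ψ) : PrimrecFormula fun k => (φ k).imp (ψ k) :=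
  Primrec₂.natPair.comp (Primrec.const 3) (Primrec₂.natPair.comp hφ hψ)

theorem PrimrecFormula.not {φ : ℕ → LPA.BoundedFormula α n} (hφ : PrimrecFormula φ) :
    PrimrecFormula fun k => (φ k).not :=
  hφ.imp (Primrec.const _)

theorem PrimrecFormula.inf {φ ψ : ℕ → LPA.BoundedFormula α n} (hφ : PrimrecFormula φ)
    (hψ : PrimrecFormula ψ) : PrimrecFormula fun k => φ k ⊓ ψ k :=
  (hφ.imp hψ.not).not

theorem PrimrecFormula.all {φ : ℕ → LPA.BoundedFormula α (n + 1)} (hφ : PrimrecFormula φ) :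
    PrimrecFormula fun k => (φ k).all :=
  Primrec₂.natPair.comp (Primrec.const 4) hφ

theorem PrimrecFormula.ex {φ : ℕ → LPA.BoundedFormula α (n + 1)} (hφ : PrimrecFormula φ) :
    PrimrecFormula fun k => (φ k).ex :=
  hφ.not.all.not

theorem PrimrecFormula.remF {a m r : ℕ → LPA.Term (α ⊕ Fin n)} (ha : PrimrecTerm a)
    (hm : PrimrecTerm m) (hr : PrimrecTerm r) :
    PrimrecFormula fun k => remF (a k) (m k) (r k) :=
  ((PrimrecFormula.equal ha.up (((PrimrecTerm.const _).mulT hm.up).addT hr.up)).inf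
    (PrimrecFormula.leF hr.up.succT hm.up)).ex

theorem PrimrecFormula.betaF {a b i r : ℕ → LPA.Term (α ⊕ Fin n)} (ha : PrimrecTerm a)
    (hb : PrimrecTerm b) (hi : PrimrecTerm i) (hr : PrimrecTerm r) :
    PrimrecFormula fun k => betaF (a k) (b k) (i k) (r k) :=
  PrimrecFormula.remF ha (hi.succT.mulT hb).succT hr

theorem PrimrecFormula.expF {x p : ℕ → LPA.Term (α ⊕ Fin n)} (hx : PrimrecTerm x)
    (hp : PrimrecTerm p) : PrimrecFormula fun k => expF (x k) (p k) :=
  (((PrimrecFormula.betaF (.const _) (.const _) (.const _) (.const _)).inf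
    ((PrimrecFormula.leF (.const _) hx.up.up.up).imp
      ((PrimrecFormula.betaF (.const _) (.const _) (.const _) (.const _)).inf
        (PrimrecFormula.betaF (.const _) (.const _) (.const _) (.const _))).ex).all).inf
    (PrimrecFormula.betaF (.const _) (.const _) hx.up.up hp.up.up)).ex.ex

theorem PrimrecFormula.memF {x c : ℕ → LPA.Term (α ⊕ Fin n)} (hx : PrimrecTerm x)
    (hc : PrimrecTerm c) : PrimrecFormula fun k => memF (x k) (c k) :=
  (((PrimrecFormula.expF hx.up.up.up (.const _)).inf
    (PrimrecFormula.equal hc.up.up.up (.const _))).inf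
    (PrimrecFormula.leF (.const _) (.const _))).ex.ex.ex

end PrimrecCodes

/-! ### The type to be realized, and its recursiveness. -/

/-- The formula `k ∈ x`. -/
def memX (k : ℕ) : LPA.Formula (Fin 0 ⊕ Unit) :=
  memF (numeral k) (Term.var (Sum.inl (Sum.inr ())))

/-- A formula equivalent to `k ∉ x`, arranged so that its code visibly bounds `k`. -/
def notMemX (k : ℕ) : LPA.Formula (Fin 0 ⊕ Unit) :=
  ((numeral k).bdEqual (numeral k)).imp (memX k).not

/-- The type of an element that codes the theory of the model: besides the biconditionals of
`truthType` it says that only codes of sentences are members. -/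
def theoryType : Set (LPA.Formula (Fin 0 ⊕ Unit)) :=
  truthType ∪ notMemX '' {k | ¬ ∃ φ : LPA.Sentence, code φ = k}

/-- The code of a biconditional, as a function of the codes of its sides. -/
def iffCode (a b : ℕ) : ℕ :=
  let notCode c := Nat.pair 3 (Nat.pair c (Nat.pair 0 0))
  notCode (Nat.pair 3 (Nat.pair (Nat.pair 3 (Nat.pair a b))
    (notCode (Nat.pair 3 (Nat.pair b a)))))

theorem code_iff {α : Type*} [Encodable α] {n : ℕ} (φ ψ : LPA.BoundedFormula α n) :
    code (φ.iff ψ) = iffCode (code φ) (code ψ) := rfl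

theorem primrec_iffCode : Primrec₂ iffCode := by
  have hn : Primrec fun c => Nat.pair 3 (Nat.pair c (Nat.pair 0 0)) :=
    Primrec₂.natPair.comp (Primrec.const 3) (Primrec₂.natPair.comp Primrec.id (Primrec.const _))
  have h {f g : ℕ × ℕ → ℕ} (hf : Primrec f) (hg : Primrec g) :
      Primrec fun p => Nat.pair 3 (Nat.pair (f p) (g p)) :=
    Primrec₂.natPair.comp (Primrec.const 3) (Primrec₂.natPair.comp hf hg)
  exact hn.comp (h (h Primrec.fst Primrec.snd) (hn.comp (h Primrec.snd Primrec.fst)))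

theorem le_iffCode (a b : ℕ) : a ≤ iffCode a b := by
  have h (x c d : ℕ) : c ≤ Nat.pair x (Nat.pair c d) :=
    (Nat.left_le_pair c d).trans (Nat.right_le_pair x _)
  exact ((h 3 a b).trans (h 3 _ _)).trans (h 3 _ _)

theorem primrec_code_memX : Primrec fun k => code (memX k) :=
  PrimrecFormula.memF .numeral (.const _)

theorem primrec_code_notMemX : Primrec fun k => code (notMemX k) :=
  (PrimrecFormula.equal .numeral .numeral).imp (PrimrecFormula.not primrec_code_memX)

theorem le_termCode_numeral {β : Type*} [Encodable β] (k : ℕ) :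
    k ≤ termCode (numeral k : LPA.Term β) := by
  induction k with
  | zero => exact Nat.zero_le _
  | succ k ih =>
    exact ih.trans_lt (lt_pair_of_pos (by omega) : _ < Nat.pair 3 (termCode (numeral k)))

theorem le_code_notMemX (k : ℕ) : k ≤ code (notMemX k) := by
  have h (x c d : ℕ) : c ≤ Nat.pair x (Nat.pair c d) :=
    (Nat.left_le_pair c d).trans (Nat.right_le_pair x _)
  exact ((le_termCode_numeral k).trans (h 1 _ _)).trans (h 3 _ _)

/-- The bound `c < k + 1` comes from `le_iffCode` and `le_code_notMemX`; it turns the search for a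
member with code `k` into a bounded quantifier. -/
theorem exists_mem_theoryType_code_iff (k : ℕ) :
    (∃ ψ ∈ theoryType, code ψ = k) ↔ ∃ c < k + 1,
      ((∃ φ : LPA.Sentence, code φ = c) ∧ iffCode c (code (memX c)) = k) ∨
      ((¬ ∃ φ : LPA.Sentence, code φ = c) ∧ code (notMemX c) = k) := by
  have hφ (φ : LPA.Sentence) :
      code ((Formula.relabel Empty.elim φ : LPA.Formula (Fin 0 ⊕ Unit)).iff (memX (code φ))) =
        iffCode (code φ) (code (memX (code φ))) := by
    rw [Formula.iff, code_iff]
    congr 1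
    exact code_relabel_sentence _ φ
  constructor
  · rintro ⟨ψ, ⟨φ, rfl⟩ | ⟨c, hc, rfl⟩, rfl⟩
    · exact ⟨code φ, Nat.lt_succ_of_le ((le_iffCode _ _).trans (hφ φ).ge),
        Or.inl ⟨⟨φ, rfl⟩, (hφ φ).symm⟩⟩
    · exact ⟨c, Nat.lt_succ_of_le (le_code_notMemX c), Or.inr ⟨hc, rfl⟩⟩
  · rintro ⟨c, -, ⟨⟨φ, rfl⟩, rfl⟩ | ⟨hc, rfl⟩⟩
    · exact ⟨_, Or.inl ⟨φ, rfl⟩, hφ φ⟩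
    · exact ⟨_, Or.inr ⟨c, hc, rfl⟩, rfl⟩

theorem isRecursive_theoryType : IsRecursive theoryType := by
  have hS := primrecPred_sentenceCode.comp (Primrec.fst : Primrec (Prod.fst : ℕ × ℕ → ℕ))
  have hR : PrimrecRel fun c k : ℕ =>
      ((∃ φ : LPA.Sentence, code φ = c) ∧ iffCode c (code (memX c)) = k) ∨
      ((¬ ∃ φ : LPA.Sentence, code φ = c) ∧ code (notMemX c) = k) :=
    (hS.and (Primrec.eq.comp
      (primrec_iffCode.comp Primrec.fst (primrec_code_memX.comp Primrec.fst)) Primrec.snd)).or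
    (hS.not.and (Primrec.eq.comp (primrec_code_notMemX.comp Primrec.fst) Primrec.snd))
  have hP : PrimrecPred fun k : ℕ => ∃ ψ ∈ theoryType, code ψ = k :=
    (hR.exists_lt.comp Primrec.succ Primrec.id).of_eq fun k =>
      (exists_mem_theoryType_code_iff k).symm
  exact ⟨hP.choose, hP.choose_spec.to_comp⟩

/-! ### Finite satisfiability and realization of the type. -/

section Saturation

variable {M : Type u} [LPA.Structure M]

theorem code_mem_theoryCodes_iff (φ : LPA.Sentence) : code φ ∈ theoryCodes M ↔ M ⊨ φ := by
  constructor
  · rintro ⟨ψ, hψ, h⟩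
    rwa [← code_injective h]
  · exact fun h => ⟨φ, h, rfl⟩

variable [hM : M ⊨ PA]

theorem realize_memX (k : ℕ) (a : Fin 0 → M) (c : M) :
    (memX k).Realize (Sum.elim a fun _ => c) ↔ MemCode k c := by
  rw [memCode_iff, memX, Formula.Realize, realize_memF, realize_numeral]
  rfl

theorem realize_notMemX (k : ℕ) (a : Fin 0 → M) (c : M) :
    (notMemX k).Realize (Sum.elim a fun _ => c) ↔ ¬ MemCode k c := by
  rw [← realize_memX k a]
  simp [notMemX, Formula.Realize]

theorem realize_truth_iff (φ : LPA.Sentence) (a : Fin 0 → M) (c : M) :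
    ((Formula.relabel Empty.elim φ : LPA.Formula (Fin 0 ⊕ Unit)).iff (memX (code φ))).Realize
      (Sum.elim a fun _ => c) ↔ (M ⊨ φ ↔ MemCode (code φ) c) := by
  rw [Formula.realize_iff, realize_memX, Formula.realize_relabel, Sentence.Realize]
  rw [Subsingleton.elim (_ ∘ Empty.elim : Empty → M) default]

theorem exists_realize_iff_of_mem_theoryType {ψ : LPA.Formula (Fin 0 ⊕ Unit)}
    (hψ : ψ ∈ theoryType) : ∃ k, ∀ (a : Fin 0 → M) (c : M),
      ψ.Realize (Sum.elim a fun _ => c) ↔ (k ∈ theoryCodes M ↔ MemCode k c) := by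
  rcases hψ with ⟨φ, rfl⟩ | ⟨k, hk, rfl⟩
  · exact ⟨code φ, fun a c => by
      rw [code_mem_theoryCodes_iff]; exact realize_truth_iff φ a c⟩
  · refine ⟨k, fun a c => ?_⟩
    have : k ∉ theoryCodes M := fun ⟨φ, _, h⟩ => hk ⟨φ, h⟩
    rw [realize_notMemX]
    tauto

/-- The finitely many numbers spoken of in `q` have an upper bound, and below it a standard number
agrees with `theoryCodes M`. -/
theorem exists_realizes_finite {q : Set (LPA.Formula (Fin 0 ⊕ Unit))} (hq : q ⊆ theoryType)
    (hfin : q.Finite) (a : Fin 0 → M) : ∃ c : M, Realizes q a c := by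
  choose k hk using fun ψ : q => exists_realize_iff_of_mem_theoryType (M := M) (hq ψ.2)
  have := hfin.to_subtype
  obtain ⟨n, hn⟩ := (Set.finite_range k).bddAbove
  obtain ⟨c, hc⟩ := exists_memCode_iff (M := M) (theoryCodes M) (n + 1)
  exact ⟨c, fun ψ hψ => (hk ⟨ψ, hψ⟩ a c).2
    (hc _ (Nat.lt_succ_of_le (hn ⟨⟨ψ, hψ⟩, rfl⟩)))⟩

theorem codes_of_realizes_theoryType {a : Fin 0 → M} {c : M} (h : Realizes theoryType a c) :
    Codes c (theoryCodes M) := by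
  intro k
  by_cases hk : ∃ φ : LPA.Sentence, code φ = k
  · obtain ⟨φ, rfl⟩ := hk
    rw [code_mem_theoryCodes_iff]
    exact (realize_truth_iff φ a c).1 (h _ (Or.inl ⟨φ, rfl⟩))
  · have h1 : k ∉ theoryCodes M := fun ⟨φ, _, h⟩ => hk ⟨φ, h⟩
    have h2 := (realize_notMemX k a c).1 (h _ (Or.inr ⟨k, hk, rfl⟩))
    tauto

theorem exists_codes_theory (hrs : RecursivelySaturated M) :
    ∃ c : M, Realizes truthType Fin.elim0 c ∧ Codes c (theoryCodes M) := by
  obtain ⟨c, hc⟩ := hrs 0 theoryType Fin.elim0 isRecursive_theoryType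
    fun q hq hfin => exists_realizes_finite hq hfin _
  exact ⟨c, fun ψ hψ => hc ψ (Or.inl hψ), codes_of_realizes_theoryType hc⟩

end Saturation

/-! ### The expansion to a model of TB. -/

section Expansion

variable {M : Type u} [LPA.Structure M] [hM : M ⊨ PA]

/-- The expansion of `M` in which `T` is the set of Ackermann members of `c`. -/
abbrev truthStructure (c : M) : LT.Structure M where
  funMap f := f.elim
  RelMap | TruthRel.T => fun xs => MemM (xs 0) c

/-- Terms of the language with `T` are terms of the language of arithmetic. -/
theorem exists_term_realize_eq (c : M) {β : Type*} (t : LPAT.Term β) : ∃ t' : LPA.Term β,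
    letI := truthStructure c
    ∀ v : β → M, t'.realize v = t.realize v := by
  induction t with
  | var b => exact ⟨Term.var b, fun v => rfl⟩
  | func f ts ih =>
    choose ts' h using ih
    rcases f with f | f
    · exact ⟨Term.func f ts', fun v => congrArg (Structure.funMap f) (funext fun i => h i v)⟩
    · exact f.elim

/-- Formulas of the language with `T` are formulas of the language of arithmetic with the
parameter `c`. -/
theorem exists_formula_realize_iff (c : M) {α : Type*} {n : ℕ} (φ : LPAT.BoundedFormula α n) :
    ∃ ψ : LPA.BoundedFormula (α ⊕ Unit) n,
    letI := truthStructure c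
    ∀ (v : α → M) (xs : Fin n → M),
      ψ.Realize (Sum.elim v fun _ => c) xs ↔ φ.Realize v xs := by
  let := truthStructure c
  have ht {n : ℕ} (t : LPAT.Term (α ⊕ Fin n)) : ∃ t' : LPA.Term ((α ⊕ Unit) ⊕ Fin n),
      ∀ (v : α → M) (xs : Fin n → M),
        t'.realize (Sum.elim (Sum.elim v fun _ => c) xs) = t.realize (Sum.elim v xs) := by
    obtain ⟨t', h⟩ := exists_term_realize_eq c t
    refine ⟨t'.relabel (Sum.map Sum.inl id), fun v xs => ?_⟩
    rw [Term.realize_relabel, ← h]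
    congr 1
    ext (i | i) <;> rfl
  induction φ with
  | falsum => exact ⟨.falsum, fun v xs => Iff.rfl⟩
  | equal s t =>
    obtain ⟨s', hs⟩ := ht s
    obtain ⟨t', ht⟩ := ht t
    refine ⟨.equal s' t', fun v xs => ?_⟩
    simp only [BoundedFormula.Realize, hs, ht]
  | rel R ts =>
    choose ts' h using fun i => ht (ts i)
    rcases R with R | R
    · exact ⟨.rel R ts', fun v xs =>
        iff_of_eq (congrArg (Structure.RelMap R) (funext fun i => h i v xs))⟩
    · cases R
      -- The only case with content: `T t` is replaced by `t ∈ c`, with `c` in the added free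
      -- variable.
      refine ⟨memF (ts' 0) (Term.var (Sum.inl (Sum.inr ()))), fun v xs => ?_⟩
      rw [realize_memF, h]
      rfl
  | imp φ ψ ih ih' =>
    obtain ⟨φ', hφ⟩ := ih
    obtain ⟨ψ', hψ⟩ := ih'
    exact ⟨φ'.imp ψ', fun v xs => imp_congr (hφ v xs) (hψ v xs)⟩
  | all φ ih =>
    obtain ⟨φ', hφ⟩ := ih
    exact ⟨φ'.all, fun v xs => forall_congr' fun x => hφ v _⟩

theorem realize_inductionAxiom_truthStructure (c : M) {n : ℕ} (φ : LPAT.Formula (Fin n ⊕ Unit)) :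
    letI := truthStructure c
    M ⊨ inductionAxiom incl φ := by
  let := truthStructure c
  obtain ⟨ψ, hψ⟩ := exists_formula_realize_iff c φ
  -- Moves `c` into a new last parameter, so that the induction scheme of PA applies with `n + 1`
  -- parameters.
  let ρ : (Fin n ⊕ Unit) ⊕ Unit → Fin (n + 1) ⊕ Unit :=
    Sum.elim (Sum.map Fin.castSucc id) fun _ => Sum.inl (Fin.last n)
  have h (a : Fin n → M) (x : M) :
      (Formula.relabel ρ ψ).Realize (Sum.elim (Fin.snoc a c : Fin (n + 1) → M) fun _ => x) ↔
        φ.Realize (Sum.elim a fun _ => x) := by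
    rw [Formula.realize_relabel, Formula.Realize, Formula.Realize, ← hψ]
    refine iff_of_eq (congrArg (fun w => BoundedFormula.Realize ψ w default) ?_)
    ext ((i | i) | i) <;> simp [ρ]
  rw [realize_inductionAxiom]
  intro a h0 hS x
  rw [← h] at h0 ⊢
  exact induction_of_PA _ _ h0 (fun y hy => (h a _).2 (hS y ((h a y).1 hy))) x

theorem expandsTo_TB {c : M} (hc : Codes c (theoryCodes M)) : ExpandsTo M TB := by
  let := truthStructure c
  refine ⟨inferInstance, inferInstance, ⟨?_⟩⟩
  rintro σ ((hσ | ⟨n, φ, rfl⟩) | ⟨φ, rfl⟩)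
  · have : M ⊨ incl.onTheory PA := (LHom.onTheory_model incl PA).2 hM
    exact this.realize_of_mem σ hσ
  · exact realize_inductionAxiom_truthStructure c φ
  · have h := hc (code φ)
    rw [code_mem_theoryCodes_iff, memCode_iff] at h
    rw [tarskiBiconditional, Sentence.Realize, Formula.Realize, BoundedFormula.realize_iff]
    refine Iff.trans ?_ (h.symm.trans (LHom.realize_onSentence M incl φ).symm)
    change MemM (Term.realize _ (incl.onTerm (numeral (code φ)))) c ↔ _
    rw [LHom.realize_onTerm, realize_numeral]

end Expansion

end Arith

theorem mainTheorem8 {M : Type*} [Arith.LPA.Structure M] (hPA : M ⊨ Arith.PA)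
    (hrs : Arith.RecursivelySaturated M) :
    (∃ c : M, Arith.Realizes Arith.truthType Fin.elim0 c ∧
      Arith.Codes c (Arith.theoryCodes M)) ∧
    Arith.ExpandsTo M Arith.TB := by
  obtain ⟨c, hc⟩ := Arith.exists_codes_theory hrs
  exact ⟨⟨c, hc⟩, Arith.expandsTo_TB hc.2⟩
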